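/- Let $R$ be a commutative ring with $1$, let $M$ be a simple matroid (no loops, no two distinct parallel elements) of rank $\ell$ on $[n]=\{1,\dots,n\}$, and let $E$ be the exterior algebra over $R$ on generators $e_1,\dots,e_n$. For $S=\{i_1<\cdots<i_p\}\subseteq[n]$ write $e_S=e_{i_1}\cdots e_{i_p}$; these monomials form an $R$-basis of $E$. Let $\partial:E\to E$ be the $R$-linear map of degree $-1$ with $\partial e_i=1$ and $\partial(ab)=(\partial a)b+(-1)^{\deg a}a\,\partial b$ for homogeneous $a$. Let $I$ be the Orlik–Solomon ideal of $M$, i.e. the ideal of $E$ generated by all $\partial e_S$ with $S\subseteq[n]$ dependent in $M$, and let $I^0=\{a\in E : ab=0\text{ for all }b\in I\}$ be its annihilator. A broken circuit of $M$ is a circuit with its smallest element deleted, and a set $T\subseteq[n]$ is nbc if it contains no broken circuit. For an nbc-set $T=\{i_1<\cdots<i_\ell\}$ with $\ell$ elements put $X_p=\mathrm{cl}(\{i_{\ell-p+1},\dots,i_\ell\})$ for $0\le p\le\ell$ and $S_p=X_p\setminus X_{p-1}$ for $1\le p\le \ell$, so that $(S_1,\dots,S_\ell)$ is an ordered partition of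 $[n]$, and let $$z(T)=\operatorname{sign}(\sigma)\,\partial(e_{S_1})\,\partial(e_{S_2})\cdots\partial(e_{S_\ell}),$$ where $\sigma$ is the permutation of $[n]$ that lists the elements of $S_1$ in increasing order, then those of $S_2$, and so on. Let $Z$ be the set of all $z(T)$, for $T$ an nbc-set with $\ell$ elements. Order the monomials $e_S$ degree-lexicographically: first by $|S|$, and for equal cardinality by the lexicographic order of the increasing sequences of the elements of $S$. The leading monomial of a nonzero element of $E$ is the largest monomial that occurs in it with nonzero coefficient; for $A\subseteq E$ let $\mathrm{In}(A)$ be the set of leading monomials of the nonzero elements of $A$. **Theorem.** The set $Z$ is a Gröbner basis of $I^0$ with respect to this order: $Z\subseteq I^0$, and $\mathrm{In}(I^0)$ is exactly the set of all monomials $e_S$ that are divisible by some monomial $e_U\in\mathrm{In}(Z)$ (that is, $U\subseteq S$). -/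

import Mathlib

namespace OrlikSolomon

/-- The exterior algebra `E = Λ V` over `R`, where `V` is free with basis `e_1, …, e_n`
(indexed by `Fin n` with its usual order). -/
abbrev E (R : Type*) [CommRing R] (n : ℕ) : Type _ := ExteriorAlgebra R (Fin n → R)

section Algebra

variable {R : Type*} [CommRing R] {n : ℕ}

/-- The basis of `E` given by the monomials `e_S`, for `S ⊆ [n]`, where
`e_S = e_{i_1} ⋯ e_{i_p}` for `S = {i_1 < ⋯ < i_p}`. -/
noncomputable def monomials (R : Type*) [CommRing R] (n : ℕ) :
    Module.Basis (Finset (Fin n)) R (E R n) :=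
  (Pi.basisFun R (Fin n)).ExteriorAlgebra

/-- The monomial `e_S`. -/
noncomputable def e (R : Type*) [CommRing R] {n : ℕ} (S : Finset (Fin n)) : E R n :=
  monomials R n S

/-- The coefficient of the monomial `e_S` in `a`. -/
noncomputable def coeff (a : E R n) (S : Finset (Fin n)) : R := (monomials R n).repr a S

/-- The differential `∂` of degree `-1` on `E`: left contraction with the linear form that sends
every `e_i` to `1`. It is the linear map with `∂ 1 = 0` and `∂ (v b) = (∂ v) b - v (∂ b)` for
`v ∈ V`, that is, the graded derivation with `∂ e_i = 1`. -/
noncomputable def del : E R n →ₗ[R] E R n :=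
  CliffordAlgebra.contractLeft (Q := (0 : QuadraticForm R (Fin n → R)))
    (∑ i : Fin n, LinearMap.proj i)

/-- The annihilator `I^0 = {a | a b = 0 for all b ∈ I}` of an ideal `I` of `E`. -/
def annihilator (I : TwoSidedIdeal (E R n)) : TwoSidedIdeal (E R n) :=
  TwoSidedIdeal.mk' {a | ∀ b ∈ I, a * b = 0}
    (fun b _ => zero_mul b)
    (fun {x y} hx hy b hb => by rw [add_mul, hx b hb, hy b hb, add_zero])
    (fun {x} hx b hb => by rw [neg_mul, hx b hb, neg_zero])
    (fun {x y} hy b hb => by rw [mul_assoc, hy b hb, mul_zero])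
    (fun {x y} hx b hb => by rw [mul_assoc]; exact hx (y * b) (I.mul_mem_left y b hb))

/-- The degree-lexicographic order on monomials `e_S` (identified with the sets `S`):
smaller cardinality first; sets of equal cardinality, written as increasing sequences,
are compared lexicographically. -/
def DegLexLT (S T : Finset (Fin n)) : Prop :=
  S.card < T.card ∨ (S.card = T.card ∧ S.sort (· ≤ ·) < T.sort (· ≤ ·))

/-- `e_S` is the leading (largest) monomial of `a`. The element `0` has none. -/
def IsLeadingMonomial (a : E R n) (S : Finset (Fin n)) : Prop :=
  coeff a S ≠ 0 ∧ ∀ U, coeff a U ≠ 0 → U = S ∨ DegLexLT U S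

/-- `In(A)`: the set of the leading monomials of the elements of `A`. -/
def leadingMonomials (A : Set (E R n)) : Set (Finset (Fin n)) :=
  {S | ∃ a ∈ A, IsLeadingMonomial a S}

/-- All monomials divisible by a monomial in `P`: `e_U` divides `e_S` iff `U ⊆ S`. -/
def monomialMultiples (P : Set (Finset (Fin n))) : Set (Finset (Fin n)) :=
  {S | ∃ U ∈ P, U ⊆ S}

/-- `G` is a Gröbner basis of the ideal `J` of `E` for the degree-lexicographic order:
`G ⊆ J` and `In(J)` is the set of all monomials divisible by some monomial in `In(G)`. -/
def IsGroebnerBasis (G : Set (E R n)) (J : TwoSidedIdeal (E R n)) : Prop :=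
  (∀ g ∈ G, g ∈ J) ∧
    leadingMonomials {a | a ∈ J} = monomialMultiples (leadingMonomials G)

end Algebra

section Partitions

/-- The index of the block of the ordered partition `A` of `[n]` that contains `i`. -/
noncomputable def blockIndex {n k : ℕ} (A : Fin k → Finset (Fin n)) (i : Fin n) : ℕ :=
  sInf {p : ℕ | ∃ h : p < k, i ∈ A ⟨p, h⟩}

/-- The shuffle of an ordered partition `A` of `[n]`: the permutation whose list of values is
the increasing list of the elements of `A 0`, followed by the one of `A 1`, and so on
(`Tuple.sort` is the stable sort of `[n]` by the index of the block). -/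
noncomputable def shuffle {n k : ℕ} (A : Fin k → Finset (Fin n)) : Equiv.Perm (Fin n) :=
  Tuple.sort (blockIndex A)

/-- `z(π) = sign(σ) ∂(e_{A_1}) ⋯ ∂(e_{A_k})` for the ordered partition `π = (A_1, …, A_k)` of
`[n]` with shuffle `σ`. -/
noncomputable def zOfPartition (R : Type*) [CommRing R] {n k : ℕ}
    (A : Fin k → Finset (Fin n)) : E R n :=
  ((Equiv.Perm.sign (shuffle A) : ℤˣ) : ℤ) • (List.ofFn fun p : Fin k => del (e R (A p))).prod

end Partitions

section Matroids

variable {n : ℕ}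

/-- `M` is a simple matroid on the ground set `[n]`: no loops, and no two distinct elements are
parallel (parallel nonloops are those with the same closure). -/
structure IsSimple (M : Matroid (Fin n)) : Prop where
  ground_eq : M.E = Set.univ
  not_isLoop : ∀ i, ¬ M.IsLoop i
  eq_of_parallel : ∀ i j, M.closure {i} = M.closure {j} → i = j

/-- The Orlik–Solomon ideal of `M`: the ideal of `E` generated by `∂ e_S` for all dependent
sets `S`. -/
noncomputable def osIdeal (R : Type*) [CommRing R] (M : Matroid (Fin n)) :
    TwoSidedIdeal (E R n) :=
  TwoSidedIdeal.span {a | ∃ S : Finset (Fin n), M.Dep (S : Set (Fin n)) ∧ a = del (e R S)}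

/-- A broken circuit: a circuit with its smallest element deleted. -/
def IsBrokenCircuit (M : Matroid (Fin n)) (B : Set (Fin n)) : Prop :=
  ∃ C m, M.IsCircuit C ∧ IsLeast C m ∧ B = C \ {m}

/-- `T` is an nbc-set: it contains no broken circuit. -/
def IsNbc (M : Matroid (Fin n)) (T : Finset (Fin n)) : Prop :=
  ∀ B, IsBrokenCircuit M B → ¬ B ⊆ (T : Set (Fin n))

/-- For `T = {i_1 < ⋯ < i_ℓ}`, the flat `X_p = cl {i_{ℓ-p+1}, …, i_ℓ}` spanned by the `p` largest
elements of `T`. -/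
def flagFlat (M : Matroid (Fin n)) (T : Finset (Fin n)) (p : ℕ) : Set (Fin n) :=
  M.closure {i | i ∈ (T.sort (· ≤ ·)).drop (T.card - p)}

open scoped Classical in
/-- The ordered partition `S_p = X_p \ X_{p-1}`, `p = 1, …, ℓ`, of the flag of `T`
(here indexed from `0`). -/
noncomputable def flagPartition (M : Matroid (Fin n)) (T : Finset (Fin n)) :
    Fin T.card → Finset (Fin n) :=
  fun p => Finset.univ.filter
    fun i => i ∈ flagFlat M T ((p : ℕ) + 1) \ flagFlat M T (p : ℕ)

/-- The element `z(T)`. -/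
noncomputable def z (R : Type*) [CommRing R] (M : Matroid (Fin n)) (T : Finset (Fin n)) : E R n :=
  zOfPartition R (flagPartition M T)

end Matroids

end OrlikSolomon

/-! The key fact is that `z(T)` has leading monomial `e_{[n] \ T}` with coefficient ±1
(`exists_hasLead_z`). The leading monomial of `∂ e_A` omits `min A`. Since `T` is nbc, the least
element of each block of its flag is the element of `T` that creates the block, and leading terms of
the disjoint blocks multiply.

`z(T)` lies in `I^0` because the last block met by a circuit is met at least twice
(`exists_ne_mem_flagPartition`). For `i ≠ j` in both `A` and `S`, `e_j - e_i` divides `∂ e_S` and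
kills `∂ e_A` (`del_e_mul_del_e`).

Conversely, let `S` be leading in `a ∈ I^0`. If a broken circuit `C \ {m}` avoided `S`, then `a ∂
e_C = 0` would have a nonzero leading coefficient. So the complement of `S` is nbc. It extends to an
nbc base `T` (`IsNbc.exists_superset_closure_eq`), and the complement of `T` divides `S`. All
leading coefficients used as divisors are ±1, so zero divisors in `R` do no harm. -/

namespace OrlikSolomon

/-! ### The degree-lexicographic order as an additive integer weight. -/

section Order

variable {n : ℕ}

/-- The number whose binary digits are the indicator of `S`, the digit of `0` being the most
significant. -/
def binaryCode (S : Finset (Fin n)) : ℕ := ∑ i ∈ S, 2 ^ (i.rev : ℕ)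

/-- An additive weight on sets that is strictly monotone for the degree-lexicographic order. -/
def key (S : Finset (Fin n)) : ℕ := ∑ i ∈ S, (2 ^ n - 2 ^ (i.rev : ℕ))

lemma key_add_binaryCode (S : Finset (Fin n)) : key S + binaryCode S = S.card * 2 ^ n := by
  rw [key, binaryCode, ← Finset.sum_add_distrib, Finset.sum_congr rfl (g := fun _ => 2 ^ n)]
  · simp
  · intro i _
    exact Nat.sub_add_cancel (Nat.pow_le_pow_right (by norm_num) i.rev.isLt.le)

lemma sum_two_pow_rev_lt (l : List (Fin n)) (b : Fin n) (h : (b :: l).Pairwise (· < ·)) :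
    ((b :: l).map fun i : Fin n => 2 ^ (i.rev : ℕ)).sum < 2 ^ ((b.rev : ℕ) + 1) := by
  induction l generalizing b with
  | nil => simp [pow_succ]
  | cons c l ih =>
    have hc := ih c (List.Pairwise.of_cons h)
    have hbc : b < c := List.rel_of_pairwise_cons h (by simp)
    have : 2 ^ ((c.rev : ℕ) + 1) ≤ 2 ^ (b.rev : ℕ) :=
      Nat.pow_le_pow_right (by norm_num) (Fin.rev_lt_rev.2 hbc)
    rw [List.map_cons, List.sum_cons, pow_succ]
    omega

/-- At the first difference the smaller entry has the more significant digit, which outweighs the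
whole remaining tail of `l'`. Equal lengths exclude proper prefixes. -/
lemma sum_two_pow_rev_lt_of_lex (l l' : List (Fin n)) (h' : l'.Pairwise (· < ·))
    (hlen : l.length = l'.length) (hlt : l < l') :
    (l'.map fun i : Fin n => 2 ^ (i.rev : ℕ)).sum <
      (l.map fun i : Fin n => 2 ^ (i.rev : ℕ)).sum := by
  induction l generalizing l' with
  | nil =>
    cases l' with
    | nil => exact absurd hlt (lt_irrefl _)
    | cons _ _ => simp at hlen
  | cons a l ih =>
    cases l' with
    | nil => simp at hlen
    | cons b l' =>
      rcases List.cons_lt_cons_iff.1 hlt with hab | ⟨rfl, hl⟩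
      · have h1 := sum_two_pow_rev_lt l' b h'
        have : 2 ^ ((b.rev : ℕ) + 1) ≤ 2 ^ (a.rev : ℕ) :=
          Nat.pow_le_pow_right (by norm_num) (Fin.rev_lt_rev.2 hab)
        rw [List.map_cons (l := l), List.sum_cons]
        omega
      · have := ih l' h'.of_cons (by simpa using hlen) hl
        simpa using this

lemma binaryCode_eq_sum_sort (S : Finset (Fin n)) :
    binaryCode S = ((S.sort (· ≤ ·)).map fun i : Fin n => 2 ^ (i.rev : ℕ)).sum := by
  conv_lhs => rw [binaryCode, ← S.sort_toFinset (· ≤ ·)]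
  rw [List.sum_toFinset _ (S.sort_nodup _)]

lemma binaryCode_lt (S : Finset (Fin n)) : binaryCode S < 2 ^ n := by
  rw [binaryCode_eq_sum_sort]
  rcases h : S.sort (· ≤ ·) with _ | ⟨b, l⟩
  · simp
  · have hp : (b :: l).Pairwise (· < ·) := h ▸ S.sortedLT_sort.pairwise
    exact (sum_two_pow_rev_lt l b hp).trans_le (Nat.pow_le_pow_right (by norm_num) b.rev.isLt)

lemma key_lt_key_of_degLexLT {S T : Finset (Fin n)} (h : DegLexLT S T) : key S < key T := by
  have hS := key_add_binaryCode S
  have hT := key_add_binaryCode T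
  rcases h with h | ⟨hc, hl⟩
  · have h1 := binaryCode_lt T
    -- An extra element is worth `2 ^ n`, more than any binary code can subtract.
    have h2 : (S.card + 1) * 2 ^ n ≤ T.card * 2 ^ n := Nat.mul_le_mul_right _ h
    rw [add_mul, one_mul] at h2
    omega
  · have h1 := sum_two_pow_rev_lt_of_lex _ _ T.sortedLT_sort.pairwise (by simpa using hc) hl
    rw [← binaryCode_eq_sum_sort, ← binaryCode_eq_sum_sort] at h1
    rw [hc] at hS
    omega

lemma degLexLT_trichotomy (S T : Finset (Fin n)) : DegLexLT S T ∨ S = T ∨ DegLexLT T S := by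
  rcases lt_trichotomy S.card T.card with h | h | h
  · exact Or.inl (Or.inl h)
  · rcases lt_trichotomy (S.sort (· ≤ ·)) (T.sort (· ≤ ·)) with h' | h' | h'
    · exact Or.inl (Or.inr ⟨h, h'⟩)
    · refine Or.inr (Or.inl ?_)
      rw [← S.sort_toFinset (· ≤ ·), h', T.sort_toFinset]
    · exact Or.inr (Or.inr (Or.inr ⟨h.symm, h'⟩))
  · exact Or.inr (Or.inr (Or.inl h))

lemma degLexLT_iff_key_lt {S T : Finset (Fin n)} : DegLexLT S T ↔ key S < key T := by
  refine ⟨key_lt_key_of_degLexLT, fun h => ?_⟩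
  rcases degLexLT_trichotomy S T with h' | rfl | h'
  · exact h'
  · exact absurd h (lt_irrefl _)
  · exact absurd (key_lt_key_of_degLexLT h') h.asymm

lemma key_union {S T : Finset (Fin n)} (h : Disjoint S T) : key (S ∪ T) = key S + key T :=
  Finset.sum_union h

lemma key_insert_erase_lt {B : Finset (Fin n)} {m j : Fin n} (hm : m ∉ B) (hj : j ∈ B)
    (hmj : m < j) : key (insert m (B.erase j)) < key B := by
  have h1 : key (insert m (B.erase j)) = 2 ^ n - 2 ^ (m.rev : ℕ) + key (B.erase j) :=
    Finset.sum_insert (fun h => hm (Finset.mem_of_mem_erase h))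
  have h2 : 2 ^ n - 2 ^ (j.rev : ℕ) + key (B.erase j) = key B :=
    Finset.add_sum_erase B (fun i : Fin n => 2 ^ n - 2 ^ (i.rev : ℕ)) hj
  have h3 : 2 ^ (j.rev : ℕ) < 2 ^ (m.rev : ℕ) :=
    Nat.pow_lt_pow_right (by norm_num) (Fin.rev_lt_rev.2 hmj)
  have h4 : 2 ^ (m.rev : ℕ) ≤ 2 ^ n := Nat.pow_le_pow_right (by norm_num) m.rev.isLt.le
  omega

end Order

/-! ### Products of monomials up to sign, and the derivation rule. -/

section Monomials

variable {R : Type*} [CommRing R] {n : ℕ}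

lemma e_mul_e_of_not_disjoint {S T : Finset (Fin n)} (h : ¬ Disjoint S T) :
    e R S * e R T = 0 :=
  ExteriorAlgebra.basis_mul_of_not_disjoint (Pi.basisFun R (Fin n))
    (⟨S, rfl⟩ : Set.powersetCard (Fin n) S.card) (⟨T, rfl⟩ : Set.powersetCard (Fin n) T.card) h

lemma exists_e_mul_e {S T : Finset (Fin n)} (h : Disjoint S T) :
    ∃ s : ℤˣ, e R S * e R T = s • e R (S ∪ T) := by
  let s : Set.powersetCard (Fin n) S.card := ⟨S, rfl⟩
  let t : Set.powersetCard (Fin n) T.card := ⟨T, rfl⟩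
  have hst : Disjoint s.val t.val := h
  have hU : (Set.powersetCard.disjUnion hst).val = S ∪ T := by
    simp [Set.powersetCard.disjUnion, s, t]
  have := ExteriorAlgebra.basis_mul_of_disjoint (Pi.basisFun R (Fin n)) s t hst
  rw [hU] at this
  exact ⟨_, this⟩

lemma e_empty : e R (∅ : Finset (Fin n)) = 1 := by
  rw [e, monomials, ExteriorAlgebra.basis_apply_ofCard _ Finset.card_empty]
  simp [ExteriorAlgebra.ιMulti_family, ExteriorAlgebra.ιMulti_zero_apply]

lemma e_singleton (i : Fin n) :
    e R {i} = ExteriorAlgebra.ι R (Pi.single i 1) := by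
  rw [e, monomials, ExteriorAlgebra.basis_apply_ofCard _ (Finset.card_singleton i)]
  simp [ExteriorAlgebra.ιMulti_family, ExteriorAlgebra.ιMulti_apply]
  have h := (Set.powersetCard.mem_range_ofFinEmbEquiv_symm_iff_mem
    (Set.powersetCard.ofCard (Finset.card_singleton i)) _).1 ⟨0, rfl⟩
  rw [Finset.mem_singleton.1 h]

lemma del_ι_mul (v : Fin n → R) (b : E R n) :
    del (ExteriorAlgebra.ι R v * b) = (∑ i, v i) • b - ExteriorAlgebra.ι R v * del b := by
  have := CliffordAlgebra.contractLeft_ι_mul (Q := (0 : QuadraticForm R (Fin n → R)))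
    (d := ∑ i : Fin n, LinearMap.proj i) v b
  simpa [del] using this

lemma del_e_singleton_mul (i : Fin n) (b : E R n) :
    del (e R {i} * b) = b - e R {i} * del b := by
  rw [e_singleton, del_ι_mul]
  simp

lemma del_one : del (1 : E R n) = 0 := CliffordAlgebra.contractLeft_one _ _

end Monomials

end OrlikSolomon

namespace OrlikSolomon

/-! ### Leading terms, their products, and the leading term of `∂ e_A`. -/

section Leading

variable {R : Type*} [CommRing R] {n : ℕ}

/-- The span of the monomials of weight less than `k`. -/
noncomputable def lowerSpan (R : Type*) [CommRing R] (n k : ℕ) : Submodule R (E R n) :=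
  Submodule.span R (e R '' {U | key U < k})

/-- `a` is `c e_S` plus a combination of monomials smaller than `e_S`. -/
def HasLead (c : R) (a : E R n) (S : Finset (Fin n)) : Prop :=
  a - c • e R S ∈ lowerSpan R n (key S)

lemma e_mem_lowerSpan {k : ℕ} {U : Finset (Fin n)} (h : key U < k) : e R U ∈ lowerSpan R n k :=
  Submodule.subset_span ⟨U, h, rfl⟩

lemma units_smul_mem {P : Submodule R (E R n)} (s : ℤˣ) {x : E R n} (hx : x ∈ P) :
    s • x ∈ P := by
  rcases Int.units_eq_one_or s with rfl | rfl
  · simpa using hx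
  · simpa [Units.smul_def] using hx

lemma lowerSpan_mono {j k : ℕ} (h : j ≤ k) : lowerSpan R n j ≤ lowerSpan R n k :=
  Submodule.span_mono (Set.image_mono fun _ hU => lt_of_lt_of_le hU h)

lemma e_mul_e_mem_lowerSpan {k : ℕ} {U V : Finset (Fin n)} (h : key U + key V < k) :
    e R U * e R V ∈ lowerSpan R n k := by
  by_cases hd : Disjoint U V
  · obtain ⟨s, hs⟩ := exists_e_mul_e (R := R) hd
    rw [hs]
    exact units_smul_mem s (e_mem_lowerSpan (by rwa [key_union hd]))
  · rw [e_mul_e_of_not_disjoint hd]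
    exact Submodule.zero_mem _

/-- The bound is left as the hypothesis `hm` so that one factor may attain its leading weight while
the other stays strictly below. -/
lemma mul_mem_lowerSpan {j k m : ℕ} (hm : ∀ p q : ℕ, p < j → q < k → p + q < m) {a b : E R n}
    (ha : a ∈ lowerSpan R n j) (hb : b ∈ lowerSpan R n k) : a * b ∈ lowerSpan R n m := by
  have h : lowerSpan R n j * lowerSpan R n k ≤ lowerSpan R n m := by
    rw [lowerSpan, lowerSpan, Submodule.span_mul_span, Submodule.span_le]
    rintro _ ⟨_, ⟨U, hU, rfl⟩, _, ⟨V, hV, rfl⟩, rfl⟩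
    exact e_mul_e_mem_lowerSpan (hm _ _ hU hV)
  exact h (Submodule.mul_mem_mul ha hb)

lemma HasLead.mem {c : R} {a : E R n} {S : Finset (Fin n)} (h : HasLead c a S) :
    a ∈ lowerSpan R n (key S + 1) := by
  rw [← sub_add_cancel a (c • e R S)]
  exact Submodule.add_mem _ (lowerSpan_mono (Nat.le_succ _) h)
    (Submodule.smul_mem _ _ (e_mem_lowerSpan (Nat.lt_succ_self _)))

/-- Weights add over disjoint sets, so every cross term is strictly smaller. The coefficient `c * d`
may vanish; nonvanishing is checked only where it is used. -/
lemma HasLead.mul {c d : R} {a b : E R n} {S T : Finset (Fin n)} (ha : HasLead c a S)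
    (hb : HasLead d b T) (h : Disjoint S T) :
    ∃ s : ℤˣ, HasLead (s • (c * d)) (a * b) (S ∪ T) := by
  obtain ⟨s, hs⟩ := exists_e_mul_e (R := R) h
  refine ⟨s, ?_⟩
  have heq : a * b - (s • (c * d)) • e R (S ∪ T) =
      (a - c • e R S) * b + (c • e R S) * (b - d • e R T) := by
    rw [smul_assoc, ← smul_comm, ← hs]
    simp only [sub_mul, mul_sub, smul_mul_smul_comm]
    abel
  rw [HasLead, heq, key_union h]
  exact Submodule.add_mem _ (mul_mem_lowerSpan (by omega) ha hb.mem)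
    (mul_mem_lowerSpan (j := key S + 1) (by omega)
      (Submodule.smul_mem _ _ (e_mem_lowerSpan (Nat.lt_succ_self _))) hb)

lemma HasLead.smul {c : R} {a : E R n} {S : Finset (Fin n)} (h : HasLead c a S) (s : ℤˣ) :
    HasLead (s • c) (s • a) S := by
  rw [HasLead, smul_assoc, ← smul_sub]
  exact units_smul_mem s h

lemma hasLead_e (S : Finset (Fin n)) : HasLead (1 : R) (e R S) S := by
  simp [HasLead]

lemma coeff_e (S U : Finset (Fin n)) : coeff (e R S) U = if S = U then 1 else 0 := by
  simp [coeff, e, Finsupp.single_apply]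

lemma mem_lowerSpan_iff {k : ℕ} {a : E R n} :
    a ∈ lowerSpan R n k ↔ ∀ U, coeff a U ≠ 0 → key U < k := by
  rw [lowerSpan]
  refine (Module.Basis.mem_span_image (monomials R n)).trans ?_
  simp [Set.subset_def, coeff]

lemma coeff_sub_smul_e (a : E R n) (c : R) (S U : Finset (Fin n)) :
    coeff (a - c • e R S) U = coeff a U - if S = U then c else 0 := by
  have := coeff_e (R := R) S U
  simp only [coeff] at this ⊢
  simp [this]

lemma HasLead.coeff_eq {c : R} {a : E R n} {S : Finset (Fin n)} (h : HasLead c a S) :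
    coeff a S = c := by
  by_contra hne
  refine lt_irrefl (key S) (mem_lowerSpan_iff.1 h S ?_)
  rwa [coeff_sub_smul_e, if_pos rfl, sub_ne_zero]

lemma HasLead.isLeadingMonomial {c : R} {a : E R n} {S : Finset (Fin n)} (h : HasLead c a S)
    (hc : c ≠ 0) : IsLeadingMonomial a S := by
  refine ⟨h.coeff_eq.trans_ne hc, fun U hU => ?_⟩
  by_cases hSU : S = U
  · exact Or.inl hSU.symm
  · refine Or.inr (degLexLT_iff_key_lt.2 (mem_lowerSpan_iff.1 h U ?_))
    rwa [coeff_sub_smul_e, if_neg hSU, sub_zero]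

lemma IsLeadingMonomial.hasLead {a : E R n} {S : Finset (Fin n)} (h : IsLeadingMonomial a S) :
    HasLead (coeff a S) a S := by
  refine mem_lowerSpan_iff.2 fun U hU => ?_
  rw [coeff_sub_smul_e] at hU
  by_cases hSU : S = U
  · subst hSU
    simp at hU
  · rw [if_neg hSU, sub_zero] at hU
    exact degLexLT_iff_key_lt.1 ((h.2 U hU).resolve_left fun h' => hSU h'.symm)

lemma IsLeadingMonomial.eq {a : E R n} {S T : Finset (Fin n)} (hS : IsLeadingMonomial a S)
    (hT : IsLeadingMonomial a T) : S = T := by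
  rcases hT.2 S hS.1 with h | h
  · exact h
  rcases hS.2 T hT.1 with h' | h'
  · exact h'.symm
  · exact absurd (degLexLT_iff_key_lt.1 h) (degLexLT_iff_key_lt.1 h').asymm

lemma exists_e_insert {i : Fin n} {S : Finset (Fin n)} (h : i ∉ S) :
    ∃ s : ℤˣ, e R (insert i S) = s • (e R {i} * e R S) := by
  obtain ⟨s, hs⟩ := exists_e_mul_e (R := R) (Finset.disjoint_singleton_left.2 h)
  refine ⟨s, ?_⟩
  rw [hs, smul_smul, Int.units_mul_self, one_smul, Finset.insert_eq]

lemma del_units_smul (s : ℤˣ) (a : E R n) : del (s • a) = s • del a := by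
  rcases Int.units_eq_one_or s with rfl | rfl <;> simp [Units.smul_def]

lemma del_e_mem_span (S : Finset (Fin n)) :
    del (e R S) ∈ Submodule.span R ((fun j => e R (S.erase j)) '' (S : Set (Fin n))) := by
  induction S using Finset.induction_on with
  | empty => simp [e_empty, del_one]
  | insert i S hi ih =>
    obtain ⟨s, hs⟩ := exists_e_insert (R := R) hi
    rw [hs, del_units_smul, del_e_singleton_mul]
    refine units_smul_mem s (Submodule.sub_mem _ (Submodule.subset_span ⟨i, by simp, ?_⟩) ?_)
    · simp [Finset.erase_insert hi]
    · refine (Submodule.span_le (p := Submodule.comap (LinearMap.mulLeft R (e R {i}))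
        (Submodule.span R _))).2 ?_ ih
      rintro _ ⟨j, hj, rfl⟩
      have hij : i ≠ j := fun h => hi (h ▸ hj)
      obtain ⟨t, ht⟩ := exists_e_mul_e (R := R) (S := {i}) (T := S.erase j)
        (Finset.disjoint_singleton_left.2 fun h => hi (Finset.mem_of_mem_erase h))
      simp only [SetLike.mem_coe, Submodule.mem_comap, LinearMap.mulLeft_apply]
      rw [ht]
      refine units_smul_mem t (Submodule.subset_span ⟨j, by simp [Finset.mem_coe.1 hj], ?_⟩)
      simp only
      rw [Finset.erase_insert_of_ne hij, Finset.insert_eq]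

/-- The leading monomial of `∂ e_A` is `e_A` with its smallest element deleted. -/
lemma exists_hasLead_del_e {A : Finset (Fin n)} {m : Fin n} (hm : m ∈ A)
    (hmin : ∀ j ∈ A, m ≤ j) : ∃ s : ℤˣ, HasLead (s • (1 : R)) (del (e R A)) (A.erase m) := by
  obtain ⟨s, hs⟩ := exists_e_insert (R := R) (Finset.notMem_erase m A)
  rw [Finset.insert_erase hm] at hs
  refine ⟨s, ?_⟩
  rw [hs, del_units_smul, del_e_singleton_mul]
  refine HasLead.smul ?_ s
  -- The remainder is `-e_m ∂ e_{A \ m}`, whose monomials replace some `j > m` of `A \ m` by `m` and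
  -- so have smaller weight.
  rw [HasLead, one_smul, sub_sub_cancel_left]
  refine Submodule.neg_mem _ ?_
  refine (Submodule.span_le (p := Submodule.comap (LinearMap.mulLeft R (e R {m}))
    (lowerSpan R n _))).2 ?_ (del_e_mem_span _)
  rintro _ ⟨j, hj, rfl⟩
  rw [Finset.mem_coe] at hj
  have hmj : m < j := lt_of_le_of_ne (hmin j (Finset.mem_of_mem_erase hj))
    (Finset.ne_of_mem_erase hj).symm
  have hd : Disjoint {m} ((A.erase m).erase j) := by simp
  have := key_insert_erase_lt (Finset.notMem_erase m A) hj hmj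
  rw [Finset.insert_eq, key_union hd] at this
  exact e_mul_e_mem_lowerSpan this

lemma exists_hasLead_prod {k : ℕ} (a : Fin k → E R n) (A : Fin k → Finset (Fin n))
    (h : ∀ p, ∃ s : ℤˣ, HasLead (s • (1 : R)) (a p) (A p))
    (hA : ∀ p q, p ≠ q → Disjoint (A p) (A q)) :
    ∃ s : ℤˣ, HasLead (s • (1 : R)) (List.ofFn a).prod (Finset.univ.biUnion A) := by
  induction k with
  | zero => exact ⟨1, by simpa [e_empty] using hasLead_e (R := R) (∅ : Finset (Fin n))⟩
  | succ k ih =>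
    obtain ⟨s, hs⟩ := h 0
    obtain ⟨t, ht⟩ := ih (fun p => a p.succ) (fun p => A p.succ) (fun p => h p.succ)
      (fun p q hpq => hA _ _ fun h => hpq (Fin.succ_injective _ h))
    obtain ⟨u, hu⟩ := hs.mul ht <| by
      rw [Finset.disjoint_biUnion_right]
      exact fun p _ => hA _ _ (Fin.succ_ne_zero p).symm
    refine ⟨u * (s * t), ?_⟩
    have hU : Finset.univ.biUnion A = A 0 ∪ Finset.univ.biUnion fun p : Fin k => A p.succ := by
      ext i
      simp [Fin.exists_fin_succ]
    rw [hU, List.ofFn_succ, List.prod_cons]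
    rw [smul_mul_smul_comm, one_mul, smul_smul] at hu
    exact hu

end Leading

/-! ### Sign commutation and the vanishing of products `∂ e_A ∂ e_S`. -/

section Contraction

variable {R : Type*} [CommRing R] {n : ℕ}

/-- `d` commutes with every vector up to a sign `ε`. -/
def SignCommutes (ε : R) (d : E R n) : Prop :=
  ∀ v, ExteriorAlgebra.ι R v * d = ε • (d * ExteriorAlgebra.ι R v)

lemma SignCommutes.units_smul {ε : R} {d : E R n} (h : SignCommutes ε d) (s : ℤˣ) :
    SignCommutes ε (s • d) := by
  intro v
  rcases Int.units_eq_one_or s with rfl | rfl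
  · simpa using h v
  · simpa [Units.smul_def] using h v

lemma ι_mul_ι_swap (v w : Fin n → R) (x : E R n) :
    ExteriorAlgebra.ι R v * (ExteriorAlgebra.ι R w * x) =
      -(ExteriorAlgebra.ι R w * (ExteriorAlgebra.ι R v * x)) := by
  rw [← mul_assoc, ← mul_assoc, ← neg_mul]
  congr 1
  exact eq_neg_of_add_eq_zero_left (ExteriorAlgebra.ι_add_mul_swap v w)

lemma SignCommutes.ι_mul {ε : R} {d : E R n} (h : SignCommutes ε d) (w : Fin n → R) :
    SignCommutes (-ε) (ExteriorAlgebra.ι R w * d) := by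
  intro v
  rw [ι_mul_ι_swap, h v, neg_smul, mul_smul_comm, mul_assoc]

/-- The sign is `(-1)^|S|`, and `∂` lowers the degree by one; only `ε² = 1` is needed later. -/
lemma exists_signCommutes_e (S : Finset (Fin n)) :
    ∃ ε : R, ε * ε = 1 ∧ SignCommutes ε (e R S) ∧ SignCommutes (-ε) (del (e R S)) := by
  induction S using Finset.induction_on with
  | empty => exact ⟨1, one_mul 1, fun v => by simp [e_empty], fun v => by simp [e_empty, del_one]⟩
  | insert i S hi ih =>
    obtain ⟨ε, hε, h1, h2⟩ := ih
    obtain ⟨s, hs⟩ := exists_e_insert (R := R) hi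
    refine ⟨-ε, by simpa using hε, ?_, ?_⟩
    · rw [hs, e_singleton]
      exact (h1.ι_mul _).units_smul s
    · rw [hs, del_units_smul, del_e_singleton_mul, e_singleton]
      refine SignCommutes.units_smul (fun v => ?_) s
      rw [mul_sub, sub_mul, smul_sub, h2.ι_mul, h1 v, neg_neg]

lemma exists_signCommutes_del_e (S : Finset (Fin n)) :
    ∃ ε : R, ε * ε = 1 ∧ SignCommutes ε (del (e R S)) := by
  obtain ⟨ε, hε, -, h⟩ := exists_signCommutes_e (R := R) S
  exact ⟨-ε, by simpa using hε, h⟩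

lemma SignCommutes.exists_mul_eq {ε : R} {d : E R n} (h : SignCommutes ε d) (x : E R n) :
    ∃ y, x * d = d * y := by
  induction x using ExteriorAlgebra.induction with
  | algebraMap r => exact ⟨algebraMap R _ r, Algebra.commutes _ _⟩
  | ι v => exact ⟨ε • ExteriorAlgebra.ι R v, by rw [h v, mul_smul_comm]⟩
  | mul a b ha hb =>
    obtain ⟨a', ha⟩ := ha
    obtain ⟨b', hb⟩ := hb
    exact ⟨a' * b', by rw [mul_assoc, hb, ← mul_assoc, ha, mul_assoc]⟩
  | add a b ha hb =>
    obtain ⟨a', ha⟩ := ha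
    obtain ⟨b', hb⟩ := hb
    exact ⟨a' + b', by rw [add_mul, ha, hb, mul_add]⟩

lemma e_singleton_mul_e {i : Fin n} {S : Finset (Fin n)} (h : i ∈ S) : e R {i} * e R S = 0 :=
  e_mul_e_of_not_disjoint (by simpa using h)

lemma e_singleton_mul_del_e {i : Fin n} {S : Finset (Fin n)} (h : i ∈ S) :
    e R {i} * del (e R S) = e R S := by
  have := del_e_singleton_mul i (e R S)
  rw [e_singleton_mul_e h, map_zero] at this
  exact (sub_eq_zero.1 this.symm).symm

lemma exists_e_eq_mul_mul {i j : Fin n} (hij : i ≠ j) {S : Finset (Fin n)} (hi : i ∈ S)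
    (hj : j ∈ S) : ∃ w, e R S = e R {i} * (e R {j} * w) := by
  obtain ⟨s, hs⟩ := exists_e_insert (R := R) (Finset.notMem_erase i S)
  obtain ⟨t, ht⟩ := exists_e_insert (R := R) (Finset.notMem_erase j (S.erase i))
  rw [Finset.insert_erase hi] at hs
  rw [Finset.insert_erase (Finset.mem_erase.2 ⟨hij.symm, hj⟩)] at ht
  exact ⟨s • t • e R ((S.erase i).erase j), by rw [hs, ht]; simp only [mul_smul_comm]⟩

lemma exists_del_e_eq_mul {i j : Fin n} (hij : i ≠ j) {S : Finset (Fin n)} (hi : i ∈ S)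
    (hj : j ∈ S) : ∃ w, del (e R S) = (e R {j} - e R {i}) * w := by
  obtain ⟨w, hw⟩ := exists_e_eq_mul_mul (R := R) hij hi hj
  -- Since `e_i e_j = e_i (e_j - e_i)` and `∂ (e_j - e_i) = 0`, the Leibniz rule lets `e_j - e_i` be
  -- factored out, leaving this cofactor.
  refine ⟨w - e R {i} * del w, ?_⟩
  have h0 : e R {i} * (e R {i} * del w) = 0 := by
    rw [← mul_assoc, e_singleton_mul_e (by simp), zero_mul]
  have h1 : e R {j} * (e R {i} * del w) = -(e R {i} * (e R {j} * del w)) := by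
    rw [e_singleton, e_singleton, ι_mul_ι_swap]
  rw [hw, del_e_singleton_mul, del_e_singleton_mul]
  simp only [sub_mul, mul_sub, h0, h1]
  abel

lemma del_e_mul_del_e {i j : Fin n} (hij : i ≠ j) {A S : Finset (Fin n)} (hiA : i ∈ A)
    (hjA : j ∈ A) (hiS : i ∈ S) (hjS : j ∈ S) : del (e R A) * del (e R S) = 0 := by
  obtain ⟨w, hw⟩ := exists_del_e_eq_mul (R := R) hij hiS hjS
  obtain ⟨ε, hε, hd⟩ := exists_signCommutes_del_e (R := R) A
  have h0 : (e R {j} - e R {i}) * del (e R A) = 0 := by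
    rw [sub_mul, e_singleton_mul_del_e hjA, e_singleton_mul_del_e hiA, sub_self]
  have h1 : del (e R A) * (e R {j} - e R {i}) = ε • ((e R {j} - e R {i}) * del (e R A)) := by
    rw [e_singleton, e_singleton, ← map_sub, hd, smul_smul, hε, one_smul]
  rw [hw, ← mul_assoc, h1, h0, smul_zero, zero_mul]

lemma prod_mul_del_e {L : List (E R n)} {a : E R n} (ha : a ∈ L) {S : Finset (Fin n)}
    (h : a * del (e R S) = 0) : L.prod * del (e R S) = 0 := by
  obtain ⟨ε, -, hd⟩ := exists_signCommutes_del_e (R := R) S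
  obtain ⟨L₁, L₂, rfl⟩ := List.append_of_mem ha
  obtain ⟨y, hy⟩ := hd.exists_mul_eq L₂.prod
  rw [List.prod_append, List.prod_cons, mul_assoc, mul_assoc, hy, ← mul_assoc a, h, zero_mul,
    mul_zero]

lemma mem_annihilator {I : TwoSidedIdeal (E R n)} {a : E R n} :
    a ∈ annihilator I ↔ ∀ b ∈ I, a * b = 0 := by
  rw [annihilator, TwoSidedIdeal.mem_mk']
  rfl

/-- To annihilate the Orlik–Solomon ideal it suffices to annihilate its generators on the left. -/
lemma mem_annihilator_osIdeal {M : Matroid (Fin n)} {a : E R n}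
    (h : ∀ S : Finset (Fin n), M.Dep (S : Set (Fin n)) → a * del (e R S) = 0) :
    a ∈ annihilator (osIdeal R M) := by
  rw [mem_annihilator]
  -- Quantifying over `x` makes the right annihilator of `a` closed under left multiplication. The
  -- generators belong to it because they can be moved to the left past any `x`.
  let J : TwoSidedIdeal (E R n) := TwoSidedIdeal.mk' {b | ∀ x, a * (x * b) = 0}
    (fun x => by simp)
    (fun {b c} hb hc x => by rw [mul_add, mul_add, hb, hc, add_zero])
    (fun {b} hb x => by rw [mul_neg, mul_neg, hb, neg_zero])
    (fun {y b} hb x => by rw [← mul_assoc x]; exact hb _)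
    (fun {b y} hb x => by rw [← mul_assoc, ← mul_assoc, mul_assoc a, hb, zero_mul])
  have hJ : osIdeal R M ≤ J := by
    refine TwoSidedIdeal.span_le.2 ?_
    rintro _ ⟨S, hS, rfl⟩
    refine (TwoSidedIdeal.mem_mk' ..).2 fun x => ?_
    obtain ⟨ε, -, hd⟩ := exists_signCommutes_del_e (R := R) S
    obtain ⟨y, hy⟩ := hd.exists_mul_eq x
    rw [hy, ← mul_assoc, h S hS, zero_mul]
  intro b hb
  have := (TwoSidedIdeal.mem_mk' ..).1 (hJ hb) 1
  simpa using this

end Contraction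

end OrlikSolomon

namespace OrlikSolomon

/-! ### Nbc sets and their extension to nbc bases. -/

section Nbc

variable {n : ℕ} {M : Matroid (Fin n)}

lemma exists_isLeast {C : Set (Fin n)} (h : C.Nonempty) : ∃ m, IsLeast C m :=
  ⟨_, WellFounded.min_mem wellFounded_lt C h, fun _ hx => WellFounded.min_le wellFounded_lt hx⟩

lemma IsNbc.indep (hM : IsSimple M) {T : Finset (Fin n)} (hT : IsNbc M T) :
    M.Indep (T : Set (Fin n)) := by
  by_contra h
  obtain ⟨C, hCT, hC⟩ := Matroid.Dep.exists_isCircuit_subset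
    (M := M) (X := (T : Set (Fin n))) ⟨h, by simp [hM.ground_eq]⟩
  obtain ⟨m, hm⟩ := exists_isLeast hC.nonempty
  exact hT _ ⟨C, m, hC, hm, rfl⟩ (Set.sdiff_subset.trans hCT)

/-- Otherwise `m` would be the least element of a circuit in `D ∪ {m}`, and `T` would contain the
resulting broken circuit. -/
lemma IsNbc.exists_le_of_mem_closure {T : Finset (Fin n)} (hT : IsNbc M T) {D : Set (Fin n)}
    (hD : D ⊆ T) {m : Fin n} (hm : m ∈ M.closure D) : ∃ d ∈ D, d ≤ m := by
  by_contra! h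
  have hmD : m ∉ D := fun h' => lt_irrefl _ (h m h')
  obtain ⟨C, hCD, hC, hmC⟩ := Matroid.exists_isCircuit_of_mem_closure hm hmD
  refine hT _ ⟨C, m, hC, ⟨hmC, fun x hx => ?_⟩, rfl⟩ fun x hx => ?_
  · rcases hCD hx with rfl | h'
    · exact le_rfl
    · exact (h x h').le
  · exact hD ((hCD hx.1).resolve_left hx.2)

/-- If a new broken circuit `C \ {m}` used `j`, then `m < j` would lie in `cl T` by the choice of
`j`. Then `C \ {j}` would lie in `cl T`, forcing `j` into it. -/
lemma IsNbc.insert_least {T : Finset (Fin n)} (hT : IsNbc M T) {j : Fin n}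
    (hj : IsLeast (M.closure (T : Set (Fin n)))ᶜ j) (hM : IsSimple M) :
    IsNbc M (insert j T) := by
  have hTcl : (T : Set (Fin n)) ⊆ M.closure T := M.subset_closure _ (by simp [hM.ground_eq])
  rintro _ ⟨C, m, hC, hm, rfl⟩ hsub
  rw [Finset.coe_insert] at hsub
  by_cases hjC : j ∈ C \ {m}
  · have hmj : m < j := lt_of_le_of_ne (hm.2 hjC.1) fun h => hjC.2 h.symm
    have hmcl : m ∈ M.closure (T : Set (Fin n)) := by
      by_contra h
      exact absurd (hj.2 h) hmj.not_ge
    refine hj.1 (M.closure_subset_closure_of_subset_closure ?_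
      (hC.mem_closure_sdiff_singleton_of_mem hjC.1))
    rintro x ⟨hxC, hxj⟩
    by_cases hxm : x = m
    · exact hxm ▸ hmcl
    · exact hTcl ((hsub ⟨hxC, hxm⟩).resolve_left hxj)
  · exact hT _ ⟨C, m, hC, hm, rfl⟩ fun x hx =>
      (hsub hx).resolve_left fun h => hjC (h ▸ hx)

lemma IsNbc.exists_superset_closure_eq (hM : IsSimple M) {T : Finset (Fin n)}
    (hT : IsNbc M T) :
    ∃ T', T ⊆ T' ∧ IsNbc M T' ∧ M.closure (T' : Set (Fin n)) = Set.univ := by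
  induction hk : Tᶜ.card using Nat.strong_induction_on generalizing T with
  | _ k ih =>
    subst hk
    by_cases hcl : M.closure (T : Set (Fin n)) = Set.univ
    · exact ⟨T, subset_rfl, hT, hcl⟩
    obtain ⟨j, hj⟩ := exists_isLeast (Set.nonempty_compl.2 hcl)
    have hjT : j ∉ T := fun h =>
      hj.1 (M.subset_closure (T : Set (Fin n)) (by simp [hM.ground_eq]) h)
    have hlt : (insert j T)ᶜ.card < Tᶜ.card :=
      Finset.card_lt_card (Finset.compl_ssubset_compl.2 (Finset.ssubset_insert hjT))
    obtain ⟨T', h1, h2, h3⟩ := ih _ hlt (hT.insert_least hj hM) rfl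
    exact ⟨T', (Finset.subset_insert _ _).trans h1, h2, h3⟩

lemma IsNbc.card_eq_iff (hM : IsSimple M) {T : Finset (Fin n)} (hT : IsNbc M T) {ℓ : ℕ}
    (hℓ : M.eRank = ℓ) : T.card = ℓ ↔ M.closure (T : Set (Fin n)) = Set.univ := by
  have hI := hT.indep hM
  constructor
  · intro h
    have hr : M.eRk (T : Set (Fin n)) = M.eRank := by
      rw [hI.eRk_eq_encard, Set.encard_coe_eq_coe_finsetCard, h, hℓ]
    have hB : M.IsBase (T : Set (Fin n)) := hI.isBase_of_eRk_ge T.finite_toSet hr.ge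
    rw [hB.closure_eq, hM.ground_eq]
  · intro h
    have hB : M.IsBase (T : Set (Fin n)) :=
      hI.isBase_of_ground_subset_closure (by rw [h]; exact Set.subset_univ _)
    have := hB.encard_eq_eRank
    rw [Set.encard_coe_eq_coe_finsetCard, hℓ] at this
    exact_mod_cast this

end Nbc

/-! ### The flag of `T` and its ordered partition. -/

section Flag

variable {n : ℕ} {M : Matroid (Fin n)} {T : Finset (Fin n)}

/-- The `p`-th largest element of `T`, counted from `0`. -/
def nthLargest (T : Finset (Fin n)) (p : Fin T.card) : Fin n :=
  (T.sort (· ≤ ·))[T.card - 1 - p]'(by rw [Finset.length_sort]; omega)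

lemma nthLargest_mem (p : Fin T.card) : nthLargest T p ∈ T :=
  (Finset.mem_sort (· ≤ ·)).1 (List.getElem_mem _)

/-- The set of the `p` largest elements of `T`. -/
def topSet (T : Finset (Fin n)) (p : ℕ) : Set (Fin n) :=
  {i | i ∈ (T.sort (· ≤ ·)).drop (T.card - p)}

lemma flagFlat_eq (p : ℕ) : flagFlat M T p = M.closure (topSet T p) := rfl

lemma topSet_subset (p : ℕ) : topSet T p ⊆ T := fun _ hi =>
  (Finset.mem_sort (· ≤ ·)).1 (List.mem_of_mem_drop hi)

lemma topSet_mono {p q : ℕ} (h : p ≤ q) : topSet T p ⊆ topSet T q := fun _ hi =>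
  (List.drop_sublist_drop_left _ (Nat.sub_le_sub_left h _)).subset hi

lemma topSet_zero : topSet T 0 = ∅ := by
  ext i
  simp [topSet, List.drop_of_length_le]

lemma topSet_card : topSet T T.card = T := by
  ext i
  simp [topSet]

lemma drop_sort_eq (p : Fin T.card) :
    (T.sort (· ≤ ·)).drop (T.card - (p + 1)) =
      nthLargest T p :: (T.sort (· ≤ ·)).drop (T.card - p) := by
  have h : T.card - (p + 1 : ℕ) = T.card - 1 - p := by omega
  have h' : T.card - (p : ℕ) = T.card - 1 - p + 1 := by omega
  rw [h, h', nthLargest, ← List.drop_eq_getElem_cons]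

lemma topSet_succ (p : Fin T.card) : topSet T (p + 1) = insert (nthLargest T p) (topSet T p) := by
  ext i
  simp only [topSet, drop_sort_eq, List.mem_cons]
  rfl

lemma pairwise_drop_sort (k : ℕ) : ((T.sort (· ≤ ·)).drop k).Pairwise (· < ·) :=
  T.sortedLT_sort.pairwise.drop

lemma nthLargest_lt {p : Fin T.card} {i : Fin n} (hi : i ∈ topSet T p) : nthLargest T p < i := by
  have h := pairwise_drop_sort (T := T) (T.card - (p + 1))
  rw [drop_sort_eq] at h
  exact List.rel_of_pairwise_cons h hi

lemma exists_nthLargest_eq {i : Fin n} (hi : i ∈ T) : ∃ p, nthLargest T p = i := by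
  obtain ⟨k, hk, rfl⟩ := List.mem_iff_getElem.1 ((Finset.mem_sort (· ≤ ·)).2 hi)
  rw [Finset.length_sort] at hk
  refine ⟨⟨T.card - 1 - k, by omega⟩, ?_⟩
  simp only [nthLargest]
  congr 1
  omega

lemma mem_flagPartition {p : Fin T.card} {i : Fin n} :
    i ∈ flagPartition M T p ↔
      i ∈ M.closure (topSet T (p + 1)) ∧ i ∉ M.closure (topSet T p) := by
  classical
  simp only [flagPartition, flagFlat_eq, Finset.mem_filter, Finset.mem_univ, true_and,
    Set.mem_sdiff]

lemma nthLargest_mem_flagPartition (hM : IsSimple M) (hT : M.Indep (T : Set (Fin n)))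
    (p : Fin T.card) : nthLargest T p ∈ flagPartition M T p := by
  refine mem_flagPartition.2 ⟨M.subset_closure _ (by simp [hM.ground_eq]) ?_, fun h => ?_⟩
  · rw [topSet_succ]
    exact Set.mem_insert _ _
  · have hsub : topSet T p ⊆ (T : Set (Fin n)) \ {nthLargest T p} := fun i hi =>
      ⟨topSet_subset _ hi, (nthLargest_lt hi).ne'⟩
    exact hT.notMem_closure_sdiff_of_mem (nthLargest_mem p) (M.closure_subset_closure hsub h)

/-- This identifies the element that `∂` deletes from each block in the leading term of `z(T)`. -/
lemma nthLargest_le (hT : IsNbc M T) {p : Fin T.card} {i : Fin n}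
    (hi : i ∈ flagPartition M T p) : nthLargest T p ≤ i := by
  obtain ⟨d, hd, hdi⟩ := hT.exists_le_of_mem_closure (topSet_subset _) (mem_flagPartition.1 hi).1
  rw [topSet_succ] at hd
  rcases hd with rfl | hd
  · exact hdi
  · exact (nthLargest_lt hd).le.trans hdi

lemma disjoint_flagPartition {p q : Fin T.card} (h : p ≠ q) :
    Disjoint (flagPartition M T p) (flagPartition M T q) := by
  wlog hpq : p < q generalizing p q
  · exact (this h.symm (lt_of_le_of_ne (not_lt.1 hpq) h.symm)).symm
  rw [Finset.disjoint_left]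
  intro i hp hq
  exact (mem_flagPartition.1 hq).2 (M.closure_subset_closure (topSet_mono hpq)
    (mem_flagPartition.1 hp).1)

/-- If the flag reaches everything, a nonempty set `C` has a last block that it meets. -/
lemma exists_subset_closure_topSet (hM : IsSimple M)
    (hT : M.closure (T : Set (Fin n)) = Set.univ) {C : Set (Fin n)} (hC : C.Nonempty) :
    ∃ p : Fin T.card, C ⊆ M.closure (topSet T (p + 1)) ∧ ¬ C ⊆ M.closure (topSet T p) := by
  classical
  have hex : ∃ k, C ⊆ M.closure (topSet T k) := ⟨T.card, by rw [topSet_card, hT]; simp⟩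
  -- The flat `X_0` is the set of loops, which is empty.
  have h0 : Nat.find hex ≠ 0 := by
    intro h
    have h1 := Nat.find_spec hex
    rw [h, topSet_zero] at h1
    obtain ⟨x, hx⟩ := hC
    exact hM.not_isLoop x (h1 hx)
  have hle : Nat.find hex ≤ T.card := Nat.find_min' hex (by rw [topSet_card, hT]; simp)
  refine ⟨⟨Nat.find hex - 1, by omega⟩, ?_, Nat.find_min hex (by simp only; omega)⟩
  simp only [Nat.sub_add_cancel (Nat.one_le_iff_ne_zero.2 h0)]
  exact Nat.find_spec hex

lemma exists_mem_flagPartition (hM : IsSimple M)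
    (hT : M.closure (T : Set (Fin n)) = Set.univ) (i : Fin n) :
    ∃ p, i ∈ flagPartition M T p := by
  obtain ⟨p, h1, h2⟩ := exists_subset_closure_topSet hM hT (Set.singleton_nonempty i)
  exact ⟨p, mem_flagPartition.2 ⟨h1 rfl, fun h => h2 (by simpa using h)⟩⟩

/-- A dependent set has two elements in a common block. -/
lemma exists_ne_mem_flagPartition (hM : IsSimple M)
    (hT : M.closure (T : Set (Fin n)) = Set.univ) {S : Finset (Fin n)}
    (hS : M.Dep (S : Set (Fin n))) :
    ∃ p, ∃ i ∈ S, ∃ j ∈ S, i ≠ j ∧ i ∈ flagPartition M T p ∧ j ∈ flagPartition M T p := by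
  obtain ⟨C, hCS, hC⟩ := hS.exists_isCircuit_subset
  obtain ⟨p, h1, h2⟩ := exists_subset_closure_topSet hM hT hC.nonempty
  obtain ⟨i, hiC, hi⟩ := Set.not_subset.1 h2
  refine ⟨p, i, hCS hiC, ?_⟩
  -- If `i` were the only element of `C` in this block, `C \ {i}` would lie in the preceding flat,
  -- and hence so would `i`.
  by_contra! h
  refine hi (M.closure_subset_closure_of_subset_closure (fun j hj => ?_)
    (hC.mem_closure_sdiff_singleton_of_mem hiC))
  by_contra hj'
  exact h j (hCS hj.1) (Ne.symm hj.2) (mem_flagPartition.2 ⟨h1 hiC, hi⟩)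
    (mem_flagPartition.2 ⟨h1 hj.1, hj'⟩)

lemma biUnion_erase_flagPartition (hM : IsSimple M) (hI : M.Indep (T : Set (Fin n)))
    (hT : M.closure (T : Set (Fin n)) = Set.univ) :
    (Finset.univ.biUnion fun p => (flagPartition M T p).erase (nthLargest T p)) = Tᶜ := by
  ext i
  simp only [Finset.mem_biUnion, Finset.mem_univ, true_and, Finset.mem_erase, Finset.mem_compl]
  constructor
  · rintro ⟨p, hne, hi⟩ hiT
    obtain ⟨q, rfl⟩ := exists_nthLargest_eq hiT
    have hpq : p ≠ q := fun h => hne (h ▸ rfl)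
    exact Finset.disjoint_left.1 (disjoint_flagPartition hpq) hi
      (nthLargest_mem_flagPartition hM hI q)
  · intro hiT
    obtain ⟨p, hp⟩ := exists_mem_flagPartition hM hT i
    exact ⟨p, fun h => hiT (h ▸ nthLargest_mem p), hp⟩

end Flag

/-! ### Membership and leading monomials of `z(T)`, and the Gröbner property. -/

section Main

variable {R : Type*} [CommRing R] {n : ℕ} {M : Matroid (Fin n)} {T : Finset (Fin n)}

/-- Only the fact that the shuffle sign is a unit matters below. -/
lemma z_eq : ∃ s : ℤˣ, z R M T =
    s • (List.ofFn fun p : Fin T.card => del (e R (flagPartition M T p))).prod :=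
  ⟨_, rfl⟩

lemma z_mem_annihilator (hM : IsSimple M) (hT : M.closure (T : Set (Fin n)) = Set.univ) :
    z R M T ∈ annihilator (osIdeal R M) := by
  refine mem_annihilator_osIdeal fun S hS => ?_
  obtain ⟨s, hs⟩ := z_eq (R := R) (M := M) (T := T)
  obtain ⟨p, i, hi, j, hj, hij, hip, hjp⟩ := exists_ne_mem_flagPartition hM hT hS
  rw [hs, smul_mul_assoc, prod_mul_del_e (List.mem_ofFn.2 ⟨p, rfl⟩)
    (del_e_mul_del_e hij hip hjp hi hj), smul_zero]

/-- The leading monomial of `z(T)` is the complement of `T`. -/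
lemma exists_hasLead_z (hM : IsSimple M) (hN : IsNbc M T)
    (hT : M.closure (T : Set (Fin n)) = Set.univ) :
    ∃ s : ℤˣ, HasLead (s • (1 : R)) (z R M T) Tᶜ := by
  obtain ⟨s, hs⟩ := z_eq (R := R) (M := M) (T := T)
  have hI := hN.indep hM
  obtain ⟨t, ht⟩ := exists_hasLead_prod (R := R)
    (fun p : Fin T.card => del (e R (flagPartition M T p)))
    (fun p => (flagPartition M T p).erase (nthLargest T p))
    (fun p => exists_hasLead_del_e (nthLargest_mem_flagPartition hM hI p)
      fun j hj => nthLargest_le hN hj)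
    (fun p q hpq => (disjoint_flagPartition hpq).mono (Finset.erase_subset _ _)
      (Finset.erase_subset _ _))
  rw [biUnion_erase_flagPartition hM hI hT] at ht
  exact ⟨s * t, by rw [hs, mul_smul]; exact ht.smul s⟩

lemma units_smul_ne_zero {N : Type*} [AddCommGroup N] (s : ℤˣ) {c : N} (hc : c ≠ 0) :
    s • c ≠ 0 := (smul_ne_zero_iff_ne s).2 hc

/-- The complement of the leading monomial of an element of the annihilator is nbc. -/
lemma isNbc_compl_of_isLeadingMonomial {a : E R n} (ha : a ∈ annihilator (osIdeal R M))
    {S : Finset (Fin n)} (hS : IsLeadingMonomial a S) : IsNbc M Sᶜ := by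
  classical
  rintro _ ⟨C, m, hC, hm, rfl⟩ hsub
  have hd : Disjoint S (C.toFinset.erase m) := by
    rw [Finset.disjoint_right]
    intro i hi
    rw [Finset.mem_erase, Set.mem_toFinset] at hi
    exact Finset.mem_compl.1 (Finset.mem_coe.1 (hsub ⟨hi.2, hi.1⟩))
  obtain ⟨s, hs⟩ := exists_hasLead_del_e (R := R) (Set.mem_toFinset.2 hm.1)
    fun j hj => hm.2 (Set.mem_toFinset.1 hj)
  obtain ⟨t, ht⟩ := hS.hasLead.mul hs hd
  have h0 : a * del (e R C.toFinset) = 0 :=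
    mem_annihilator.1 ha _ (TwoSidedIdeal.subset_span
      ⟨C.toFinset, by simpa using hC.dep, rfl⟩)
  rw [h0, mul_smul_comm, mul_one] at ht
  -- By `ht` the zero product has the coefficient ±`coeff a S`, which is nonzero.
  refine units_smul_ne_zero t (units_smul_ne_zero s hS.1) ?_
  rw [← ht.coeff_eq]
  simp [coeff]

end Main

end OrlikSolomon

theorem theorem3p4 {R : Type*} [CommRing R] {n : ℕ} (M : Matroid (Fin n))
    (hM : OrlikSolomon.IsSimple M) (ℓ : ℕ) (hℓ : M.eRank = (ℓ : ℕ∞)) :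
    OrlikSolomon.IsGroebnerBasis
      {a : OrlikSolomon.E R n | ∃ T : Finset (Fin n),
        OrlikSolomon.IsNbc M T ∧ T.card = ℓ ∧ a = OrlikSolomon.z R M T}
      (OrlikSolomon.annihilator (OrlikSolomon.osIdeal R M)) := by
  open OrlikSolomon in
  refine ⟨?_, Set.Subset.antisymm ?_ ?_⟩
  · rintro _ ⟨T, hN, hT, rfl⟩
    exact z_mem_annihilator hM ((hN.card_eq_iff hM hℓ).1 hT)
  · rintro S ⟨a, ha, hS⟩
    -- A leading monomial exists only over a nontrivial ring; this makes ±1 a nonzero coefficient.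
    have hne : (1 : R) ≠ 0 := fun h => hS.1 (by rw [← mul_one (coeff a S), h, mul_zero])
    obtain ⟨T, hST, hN, hT⟩ :=
      (isNbc_compl_of_isLeadingMonomial ha hS).exists_superset_closure_eq hM
    obtain ⟨s, hs⟩ := exists_hasLead_z (R := R) hM hN hT
    exact ⟨Tᶜ, ⟨_, ⟨T, hN, (hN.card_eq_iff hM hℓ).2 hT, rfl⟩,
      hs.isLeadingMonomial (units_smul_ne_zero s hne)⟩, by
        rwa [← compl_compl S, Finset.compl_subset_compl]⟩
  · rintro S ⟨U, ⟨_, ⟨T, hN, hT, rfl⟩, hU⟩, hUS⟩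
    have hT' := (hN.card_eq_iff hM hℓ).1 hT
    have hne : (1 : R) ≠ 0 := fun h => hU.1 (by rw [← mul_one (coeff _ U), h, mul_zero])
    obtain ⟨s, hs⟩ := exists_hasLead_z (R := R) hM hN hT'
    obtain rfl := hU.eq (hs.isLeadingMonomial (units_smul_ne_zero s hne))
    -- Multiplying `z(T)` by the missing factor `e_{S \ Tᶜ}` gives an element of the ideal with
    -- leading monomial `e_S`.
    obtain ⟨t, ht⟩ := hs.mul (hasLead_e (S \ Tᶜ)) Finset.disjoint_sdiff
    rw [Finset.union_sdiff_of_subset hUS, mul_one] at ht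
    exact ⟨_, TwoSidedIdeal.mul_mem_right _ _ _ (z_mem_annihilator hM hT'),
      ht.isLeadingMonomial (units_smul_ne_zero t (units_smul_ne_zero s hne))⟩
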